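/- For a finite abelian group $G$ (written additively), a subset $A \subseteq G$ and a positive integer $h$, let $h\hat{\;}A$ denote the set of all sums of $h$ distinct elements of $A$. Let $\hat{\chi}(G,h)$ denote the restricted $h$-critical number of $G$, i.e. the smallest integer $m \leq |G|$, if one exists, such that $h\hat{\;}A = G$ for every $A \subseteq G$ with $|A| \geq m$. If $n \geq 1235$ is an odd integer, then $\hat{\chi}(\mathbb{Z}_n,3)$ exists and $$\hat{\chi}(\mathbb{Z}_n,3) \leq \tfrac{2}{5}n + 1.$$ -/

import Mathlib

/-- The `h`-fold restricted sumset of a finite set `A`: all sums of `h` distinct elements of `A`. -/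
def restrictedSumset {G : Type*} [AddCommGroup G] (h : ℕ) (A : Finset G) : Set G :=
  {x | ∃ B : Finset G, B ⊆ A ∧ B.card = h ∧ ∑ b ∈ B, b = x}

/-- The sizes `m ≤ |G|` such that every subset of `G` with at least `m` elements has
`h`-fold restricted sumset equal to `G`. The bound `m ≤ |G|` excludes the sizes for which
the condition is vacuous, so the critical number is well defined iff this set is nonempty. -/
def restrictedCriticalSizes (G : Type*) [AddCommGroup G] (h : ℕ) : Set ℕ :=
  {m | m ≤ Nat.card G ∧ ∀ A : Finset G, m ≤ A.card → restrictedSumset h A = Set.univ}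

/-- The restricted `h`-critical number of a finite abelian group `G`, meaningful when
`restrictedCriticalSizes G h` is nonempty. -/
noncomputable def restrictedCriticalNumber (G : Type*) [AddCommGroup G] (h : ℕ) : ℕ :=
  sInf (restrictedCriticalSizes G h)

/-!
Let `r` count the representations of an element as an ordered sum of two elements of `A`, and
suppose that `g` is not a sum of three distinct elements of `A`. For `z ∈ A`, a pair in `A` with sum
`g - z` contains `z` or has equal entries, so `r (g - z) ≤ 3` as the order of `G` is odd. This has
two consequences. The sets `g - z - A` with `z ∈ A` almost avoid `A`, so any two of them overlap
a lot: every element of `A - A` has many representations as a difference. And as the values of `r`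
on `g - A` are tiny while its total is `|A|²`, some `r s` is large. Translating by a popular
difference `d` changes `r` little, so `r (s + d) > 3` and `s + d ∉ g - A`, whence `A - A + A ≠ G`.

But `A - A + A = G` when `|A| > 2/5 |G|`: otherwise `|A - A| ≤ |G| - |A| < 3/2 |A|`, which makes
`A - A` a subgroup; its index is less than `5/2` and odd, hence `1`.
-/

open Finset Pointwise

theorem card_inter_add_card_inter_le {α : Type*} [DecidableEq α] (X Y Z : Finset α) :
    #(X ∩ Y) + #(Y ∩ Z) ≤ #(X ∩ Z) + #Y := by
  rw [← card_inter_add_card_union]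
  gcongr <;> grind

section Convolution

variable {G : Type*} [AddGroup G] [DecidableEq G]

theorem addConvolution_neg_add_addConvolution_le (A B : Finset G) (d x : G) :
    A.addConvolution (-A) d + A.addConvolution B x ≤ A.addConvolution B (d + x) + #A := by
  have h := card_inter_add_card_inter_le A (d +ᵥ A) ((d + x) +ᵥ -B)
  rwa [card_inter_vadd, card_vadd_inter_vadd, card_inter_vadd, neg_neg, neg_add_cancel_left,
    card_vadd_finset] at h

theorem two_mul_card_le_addConvolution_neg_add_card (A : Finset G) {B : Finset G} {x y : G}
    (hx : x ∈ B) (hy : y ∈ B) : 2 * #A ≤ A.addConvolution (-A) (x - y) + #(-B + A) := by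
  have hsub : (-x +ᵥ A) ∪ (-y +ᵥ A) ⊆ -B + A :=
    union_subset (vadd_finset_subset_add (neg_mem_neg hx))
      (vadd_finset_subset_add (neg_mem_neg hy))
  calc 2 * #A = #((-x +ᵥ A) ∩ (-y +ᵥ A)) + #((-x +ᵥ A) ∪ (-y +ᵥ A)) := by
        rw [card_inter_add_card_union, card_vadd_finset, card_vadd_finset, two_mul]
    _ ≤ A.addConvolution (-A) (x - y) + #(-B + A) := by
        rw [card_vadd_inter_vadd, neg_neg, ← sub_eq_add_neg]
        gcongr

theorem exists_addSubgroup_coe_eq_sub {A : Finset G} (hA : 2 * #(-A + A) < 3 * #A) :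
    ∃ H : AddSubgroup G, (H : Set G) = (A - A : Finset G) := by
  have popular : ∀ d ∈ A - A, #A < 2 * A.addConvolution (-A) d := by
    intro d hd
    obtain ⟨x, hx, y, hy, rfl⟩ := mem_sub.1 hd
    have := two_mul_card_le_addConvolution_neg_add_card A hx hy
    omega
  refine ⟨{ carrier := (A - A : Finset G), zero_mem' := ?zero, add_mem' := ?add, neg_mem' := ?neg },
    rfl⟩
  case zero =>
    obtain ⟨x, hx⟩ : A.Nonempty := card_pos.1 (by omega)
    exact mem_sub.2 ⟨x, hx, x, hx, sub_self x⟩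
  case add =>
    intro d e hd he
    have hsum := addConvolution_neg_add_addConvolution_le A (-A) d e
    have hd := popular d hd
    have he := popular e he
    rw [mem_coe, sub_eq_add_neg, ← addConvolution_pos]
    omega
  case neg =>
    intro d hd
    rw [mem_coe, ← neg_sub A A]
    exact neg_mem_neg hd

variable [Fintype G]

theorem two_mul_card_add_card_le_addConvolution (A B : Finset G) (x y : G) :
    2 * #A + #B ≤ Fintype.card G + A.addConvolution (-A) (x - y) +
      A.addConvolution B x + A.addConvolution B y := by
  have hinter := card_inter_add_card_union (-x +ᵥ A) (-y +ᵥ A)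
  have hunion := card_inter_add_card_union ((-x +ᵥ A) ∪ (-y +ᵥ A)) (-B)
  have hsplit := card_union_le ((-x +ᵥ A) ∩ -B) ((-y +ᵥ A) ∩ -B)
  have huniv := card_le_univ ((-x +ᵥ A) ∪ (-y +ᵥ A) ∪ -B)
  rw [← union_inter_distrib_right] at hsplit
  rw [card_vadd_inter_vadd, neg_neg, ← sub_eq_add_neg] at hinter
  simp only [card_vadd_inter, card_vadd_finset, card_neg, neg_neg] at hinter hunion hsplit
  omega

theorem sum_addConvolution (A B : Finset G) : ∑ x, A.addConvolution B x = #A * #B := by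
  rw [← card_product]
  exact (card_eq_sum_card_fiberwise fun _ _ => mem_univ _).symm

theorem exists_card_mul_card_le_addConvolution {A B C : Finset G} {k : ℕ}
    (hC : ∀ x ∈ C, A.addConvolution B x ≤ k) :
    ∃ s, #A * #B ≤ #C * k + #Cᶜ * A.addConvolution B s := by
  obtain ⟨s, hs⟩ := Finite.exists_max (A.addConvolution B)
  refine ⟨s, ?_⟩
  rw [← sum_addConvolution, ← sum_add_sum_compl C]
  exact add_le_add (sum_le_card_nsmul _ _ _ hC) (sum_le_card_nsmul _ _ _ fun x _ => hs x)

theorem card_add_card_le_of_add_ne_univ {A B : Finset G} (h : A + B ≠ univ) :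
    #A + #B ≤ Fintype.card G := by
  obtain ⟨t, ht⟩ : ∃ t, t ∉ A + B := by simpa [eq_univ_iff_forall] using h
  have hinter : #(A ∩ (t +ᵥ -B)) = 0 := by
    rwa [card_inter_vadd, neg_neg, addConvolution_eq_zero]
  have hunion := card_inter_add_card_union A (t +ᵥ -B)
  have huniv := card_le_univ (A ∪ (t +ᵥ -B))
  rw [card_vadd_finset, card_neg] at hunion
  omega

end Convolution

theorem add_add_mem_restrictedSumset_three {G : Type*} [AddCommGroup G] {A : Finset G} {a b c : G}
    (ha : a ∈ A) (hb : b ∈ A) (hc : c ∈ A) (hab : a ≠ b) (hac : a ≠ c) (hbc : b ≠ c) :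
    a + b + c ∈ restrictedSumset 3 A := by
  classical
  refine ⟨{a, b, c}, by grind, card_eq_three.2 ⟨a, b, c, hab, hac, hbc, rfl⟩, ?_⟩
  rw [sum_insert (by grind), sum_pair hbc, add_assoc]

section OddOrder

theorem eq_top_of_odd_card_of_card_lt {G : Type*} [AddGroup G] {H : AddSubgroup G}
    (hodd : Odd (Nat.card G)) (hH : Nat.card G < 3 * Nat.card H) : H = ⊤ := by
  rw [← AddSubgroup.index_eq_one]
  rw [← H.card_mul_index] at hodd hH
  obtain ⟨j, hj⟩ := (Nat.odd_mul.1 hodd).2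
  have : H.index < 3 := by
    rw [mul_comm] at hH
    exact lt_of_mul_lt_mul_right hH (Nat.zero_le _)
  omega

variable {G : Type*} [AddCommGroup G] [Fintype G] [DecidableEq G] {A : Finset G} {g : G}

theorem sub_add_self_eq_univ (hodd : Odd (Fintype.card G)) (hA : 2 * Fintype.card G < 5 * #A) :
    A - A + A = univ := by
  by_contra hne
  have hcard := card_add_card_le_of_add_ne_univ hne
  have hA₀ : A.Nonempty := card_pos.1 (by omega)
  obtain ⟨H, hH⟩ : ∃ H : AddSubgroup G, (H : Set G) = (A - A : Finset G) :=
    exists_addSubgroup_coe_eq_sub (by rw [neg_add_eq_sub]; omega)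
  have hHcard : Nat.card H = #(A - A) := by
    rw [← SetLike.coe_sort_coe, hH, Nat.card_coe_set_eq, Set.ncard_coe_finset]
  have hle : #A ≤ #(A - A) := card_le_card_sub_right hA₀
  have htop : H = ⊤ := eq_top_of_odd_card_of_card_lt
    (by rwa [Nat.card_eq_fintype_card]) (by rw [Nat.card_eq_fintype_card]; omega)
  have hfull : #(A - A) = Fintype.card G := by
    rw [← hHcard, htop, AddSubgroup.card_top, Nat.card_eq_fintype_card]
  omega

theorem addConvolution_self_le_three_of_notMem (hodd : Odd (Fintype.card G))
    (hg : g ∉ restrictedSumset 3 A) {z : G} (hz : z ∈ A) : A.addConvolution A (g - z) ≤ 3 := by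
  have hcop : (Nat.card G).Coprime 2 := by
    rwa [Nat.card_eq_fintype_card, Nat.coprime_two_right]
  obtain ⟨m, hm⟩ := (nsmulCoprime hcop).surjective (g - z)
  have hsub : ({uv ∈ A ×ˢ A | uv.1 + uv.2 = g - z} : Finset (G × G)) ⊆
      {(z, g - z - z), (g - z - z, z), (m, m)} := by
    rintro ⟨u, v⟩ huv
    simp only [mem_filter, mem_product] at huv
    obtain ⟨⟨hu, hv⟩, huv⟩ := huv
    have hcollide : z = u ∨ z = v ∨ u = v := by
      by_contra! hne
      refine hg ?_
      have hmem := add_add_mem_restrictedSumset_three hz hu hv hne.1 hne.2.1 hne.2.2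
      rwa [add_assoc, huv, add_sub_cancel] at hmem
    rcases hcollide with rfl | rfl | rfl
    · simp [← huv]
    · simp [← huv]
    · have : u = m := (nsmulCoprime hcop).injective (by rw [hm, ← huv]; exact two_nsmul u)
      simp [this]
  exact (card_le_card hsub).trans card_le_three

theorem three_mul_card_le_addConvolution_neg_of_notMem (hodd : Odd (Fintype.card G))
    (hg : g ∉ restrictedSumset 3 A) {d : G} (hd : d ∈ A - A) :
    3 * #A ≤ Fintype.card G + A.addConvolution (-A) d + 6 := by
  obtain ⟨z, hz, z', hz', rfl⟩ := mem_sub.1 hd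
  have h := two_mul_card_add_card_le_addConvolution A A (g - z') (g - z)
  rw [sub_sub_sub_cancel_left] at h
  have := addConvolution_self_le_three_of_notMem hodd hg hz
  have := addConvolution_self_le_three_of_notMem hodd hg hz'
  omega

theorem exists_card_add_ten_le_addConvolution_self_of_notMem (hodd : Odd (Fintype.card G))
    (hcard : 165 ≤ Fintype.card G) (hA : 2 * Fintype.card G < 5 * #A)
    (hg : g ∉ restrictedSumset 3 A) :
    ∃ s, Fintype.card G + 10 ≤ A.addConvolution A s + 2 * #A := by
  have hle : ∀ x ∈ g +ᵥ -A, A.addConvolution A x ≤ 3 := by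
    intro x hx
    obtain ⟨z, hz, rfl⟩ : ∃ z ∈ A, g - z = x := by
      obtain ⟨y, hy, rfl⟩ := mem_vadd_finset.1 hx
      exact ⟨-y, mem_neg'.1 hy, by simp⟩
    exact addConvolution_self_le_three_of_notMem hodd hg hz
  obtain ⟨s, hs⟩ := exists_card_mul_card_le_addConvolution hle
  refine ⟨s, ?_⟩
  have hAG : #A ≤ Fintype.card G := card_le_univ A
  rw [card_compl, card_vadd_finset, card_neg] at hs
  by_contra! hlt
  zify [hAG] at hs hA hcard hAG hlt
  set n : ℤ := (Fintype.card G : ℤ)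
  set a : ℤ := (#A : ℤ)
  have hupper : a * a ≤ a * 3 + (n - a) * (n + 9 - 2 * a) :=
    hs.trans (by gcongr <;> linarith)
  -- `25 * (a * a - a * 3 - (n - a) * (n + 9 - 2 * a))` is the sum of the next two products.
  have hpos : 0 < (5 * a - 2 * n) * (13 * n + 30 - 5 * a) := by
    apply mul_pos <;> linarith
  have hnonneg : 0 ≤ n * (n - 165) := by
    apply mul_nonneg <;> linarith
  linarith

theorem sub_add_self_ne_univ_of_notMem (hodd : Odd (Fintype.card G))
    (hcard : 165 ≤ Fintype.card G) (hA : 2 * Fintype.card G < 5 * #A)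
    (hg : g ∉ restrictedSumset 3 A) : A - A + A ≠ univ := by
  obtain ⟨s, hs⟩ := exists_card_add_ten_le_addConvolution_self_of_notMem hodd hcard hA hg
  intro huniv
  obtain ⟨d, hd, z, hz, hdz⟩ := mem_add.1 (huniv.ge (mem_univ (g - s)))
  have hshift := addConvolution_neg_add_addConvolution_le A A d s
  have hpopular := three_mul_card_le_addConvolution_neg_of_notMem hodd hg hd
  have hfew := addConvolution_self_le_three_of_notMem hodd hg hz
  rw [show g - z = d + s by grind] at hfew
  omega

end OddOrder

theorem restrictedSumset_three_eq_univ {G : Type*} [AddCommGroup G] (hodd : Odd (Nat.card G))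
    (hcard : 165 ≤ Nat.card G) {A : Finset G} (hA : 2 * Nat.card G < 5 * #A) :
    restrictedSumset 3 A = Set.univ := by
  classical
  have := Nat.finite_of_card_ne_zero hodd.pos.ne'
  have := Fintype.ofFinite G
  rw [Nat.card_eq_fintype_card] at hodd hcard hA
  refine Set.eq_univ_of_forall fun g => ?_
  by_contra hg
  exact sub_add_self_ne_univ_of_notMem hodd hcard hA hg (sub_add_self_eq_univ hodd hA)

theorem mainTheorem9_general (G : Type*) [AddCommGroup G] (hodd : Odd (Nat.card G))
    (hcard : 165 ≤ Nat.card G) :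
    (restrictedCriticalSizes G 3).Nonempty ∧
      (restrictedCriticalNumber G 3 : ℝ) ≤ 2 / 5 * (Nat.card G : ℝ) + 1 := by
  have hmem : 2 * Nat.card G / 5 + 1 ∈ restrictedCriticalSizes G 3 :=
    ⟨by omega, fun A hA => restrictedSumset_three_eq_univ hodd hcard (by omega)⟩
  refine ⟨⟨_, hmem⟩, ?_⟩
  have hle : 5 * restrictedCriticalNumber G 3 ≤ 2 * Nat.card G + 5 := by
    have : restrictedCriticalNumber G 3 ≤ 2 * Nat.card G / 5 + 1 := Nat.sInf_le hmem
    omega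
  have hle' : 5 * (restrictedCriticalNumber G 3 : ℝ) ≤ 2 * Nat.card G + 5 := by exact_mod_cast hle
  linarith

theorem mainTheorem9 (n : ℕ) (hn : 1235 ≤ n) (hodd : Odd n) :
    (restrictedCriticalSizes (ZMod n) 3).Nonempty ∧
      (restrictedCriticalNumber (ZMod n) 3 : ℝ) ≤ 2 / 5 * (n : ℝ) + 1 := by
  simpa only [Nat.card_zmod] using
    mainTheorem9_general (ZMod n) (by rwa [Nat.card_zmod]) (by rw [Nat.card_zmod]; omega)
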